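/- **Theorem (Improved Sudakov Minoration).** There is a universal constant $C \geq 1$ (independent of all other parameters, in particular of the dimension) such that for every $n \geq 1$, every non-empty compact set $K \subset \mathbb{R}^n$ and every $t > 0$, $$ M\bigl(K,\; C\, t\, M^*(K)\, B_2^n\bigr) \;\leq\; \exp\left( \frac{n}{\max(t,t^2)} \right). $$ Here $B_2^n$ is the closed Euclidean unit ball of $\mathbb{R}^n$; $M(A,B)$ denotes the packing number of $B$ in $A$, i.e. the maximal integer $M$ for which there exist points $x_1,\dots,x_M \in A$ such that the translates $x_i + B$ are mutually disjoint; and $$ M^*(K) := \int_{S^{n-1}} h_K(\theta)\, d\sigma(\theta), \qquad h_K(\theta) := \max_{x \in K} \langle x,\theta\rangle, $$ is half the mean width of $K$, where $\sigma$ is the rotation-invariant probability measure on the Euclidean unit sphere $S^{n-1}$. -/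

import Mathlib

open MeasureTheory
open scoped Pointwise ENNReal

noncomputable section

namespace SudakovMinoration

/-- The packing number `M(A, B)` of `B` in `A`: the largest number `M` of points
`x 0, …, x (M - 1)` of `A` whose translates `x i + B` are mutually disjoint. It is an element of
`ℕ∞`, hence `⊤` if there are arbitrarily large such families; a finite value is attained. -/
def packingNumber {E : Type*} [AddGroup E] (A B : Set E) : ℕ∞ :=
  ⨆ (M : ℕ) (_ : ∃ x : Fin M → E,
    (∀ i, x i ∈ A) ∧ Pairwise fun i j => Disjoint (x i +ᵥ B) (x j +ᵥ B)), (M : ℕ∞)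

/-- The support function `h_K(θ) = max {⟨x, θ⟩ : x ∈ K}`; for a nonempty compact set `K` the
supremum is a maximum. -/
def supportFunction {n : ℕ} (K : Set (EuclideanSpace ℝ (Fin n))) (θ : EuclideanSpace ℝ (Fin n)) :
    ℝ :=
  sSup ((fun x => inner ℝ x θ) '' K)

/-- The rotation-invariant probability measure `σ` on the Euclidean unit sphere of `ℝⁿ`, `n ≥ 1`:
the surface measure divided by its total mass. -/
def sphereProb (n : ℕ) : Measure (Metric.sphere (0 : EuclideanSpace ℝ (Fin n)) 1) :=
  ((volume : Measure (EuclideanSpace ℝ (Fin n))).toSphere Set.univ)⁻¹ •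
    (volume : Measure (EuclideanSpace ℝ (Fin n))).toSphere

/-- Half the mean width, `M*(K) = ∫ h_K dσ` over the unit sphere. (For compact `K` the integrand
is continuous and bounded, hence integrable.) -/
def halfMeanWidth {n : ℕ} (K : Set (EuclideanSpace ℝ (Fin n))) : ℝ :=
  ∫ θ, supportFunction K θ ∂(sphereProb n)

end SudakovMinoration

end

/-! Two points of `K` at distance more than `δ` satisfy `δ ^ 2 < ‖x - y‖ ^ 2 = ⟪x - y, x - y⟫ ≤ p (x
- y)`, where `p` is the width seminorm of `K`. Within a Euclidean ball, separated points are thus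
`p`-separated, and dual Sudakov (`card_le_of_seminorm_separated`) counts them by packing disjoint
translates of `{p ≤ 4A}` into Gaussian space. Iterating over dyadic scales sums a geometric series
and gives classical Sudakov, with exponent of order `(A / δ) ^ 2`. Polar coordinates bound the
Gaussian mean of `p` by `A = 4 √n M*(K)`, so the exponent is of order `n (M*(K) / δ) ^ 2`.

For `t ≥ 1` this is the claim. For `t < 1` classical Sudakov is used only at the scale `M*(K)`,
where it costs a small multiple of `n`; inside each ball of that radius the volumetric bound `(1 + R
/ r) ^ n` replaces the exponent `n / t ^ 2` by `n / t`. -/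

open MeasureTheory
open scoped Pointwise ENNReal

namespace SudakovMinoration

/-! ### Separated sets, nets and volume -/

section Net

variable {E : Type*} [PseudoMetricSpace E]

/-- Every finite set contains an `η`-separated subset which is also an `η`-net. -/
lemma exists_separated_net (X : Finset E) {η : ℝ} (hη : 0 ≤ η) :
    ∃ Y ⊆ X, (Y : Set E).Pairwise (fun x y => η < dist x y) ∧
      ∀ x ∈ X, ∃ y ∈ Y, dist x y ≤ η := by
  classical
  have hne : (X.powerset.filter
      fun Y : Finset E => (Y : Set E).Pairwise (fun x y => η < dist x y)).Nonempty :=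
    ⟨∅, by simp⟩
  -- A separated subset of maximal cardinality is a net: a point far from all of it could be added.
  obtain ⟨Y, hY, hmax⟩ := Finset.exists_max_image _ Finset.card hne
  simp only [Finset.mem_filter, Finset.mem_powerset] at hY hmax
  refine ⟨Y, hY.1, hY.2, fun x hx => ?_⟩
  by_contra! h
  have hxY : x ∉ Y := fun hxY => by simpa using (h x hxY).trans_le' hη
  have := hmax (insert x Y) ⟨Finset.insert_subset hx hY.1, by
    rw [Finset.coe_insert]
    exact hY.2.insert fun y hy _ => ⟨h y hy, dist_comm x y ▸ h y hy⟩⟩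
  rw [Finset.card_insert_of_notMem hxY] at this
  omega

/-- The cardinality of a finite set is bounded by the size of a separated subset times the size of
its parts at small scale. -/
lemma card_le_mul_of_separated (X : Finset E) {η a b : ℝ} (hη : 0 ≤ η) (hb : 0 ≤ b)
    (hYa : ∀ Y ⊆ X, (Y : Set E).Pairwise (fun x y => η < dist x y) → (Y.card : ℝ) ≤ a)
    (hXb : ∀ y ∈ X, ∀ Z ⊆ X, (∀ z ∈ Z, dist z y ≤ η) → (Z.card : ℝ) ≤ b) :
    (X.card : ℝ) ≤ a * b := by
  classical
  obtain ⟨Y, hYX, hY, hnet⟩ := exists_separated_net X hη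
  have hsub : X ⊆ Y.biUnion fun y => X.filter fun x => dist x y ≤ η := fun x hx => by
    obtain ⟨y, hy, hxy⟩ := hnet x hx
    exact Finset.mem_biUnion.2 ⟨y, hy, Finset.mem_filter.2 ⟨hx, hxy⟩⟩
  calc (X.card : ℝ) ≤ ∑ y ∈ Y, ((X.filter fun x => dist x y ≤ η).card : ℝ) := by
        exact_mod_cast (Finset.card_le_card hsub).trans Finset.card_biUnion_le
    _ ≤ ∑ _y ∈ Y, b := Finset.sum_le_sum fun y hy =>
        hXb y (hYX hy) _ (Finset.filter_subset _ _) fun z hz => (Finset.mem_filter.1 hz).2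
    _ = Y.card * b := by simp
    _ ≤ a * b := by gcongr; exact hYa Y hYX hY

end Net

/-- Volumetric bound for the cardinality of a separated subset of a ball. -/
lemma card_le_of_separated_subset_closedBall {E : Type*} [NormedAddCommGroup E] [NormedSpace ℝ E]
    [FiniteDimensional ℝ E] (X : Finset E) {R r : ℝ} (hr : 0 < r) (hR : 0 ≤ R) (y : E)
    (hX : ∀ x ∈ X, dist x y ≤ R) (hsep : (X : Set E).Pairwise fun x z => 2 * r < dist x z) :
    (X.card : ℝ) ≤ (1 + R / r) ^ Module.finrank ℝ E := by
  classical
  borelize E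
  let μ : Measure E := Measure.addHaar
  have hdisj : (X : Set E).PairwiseDisjoint fun x => Metric.ball x r := fun x hx z hz hxz =>
    Metric.ball_disjoint_ball (by linarith [hsep hx hz hxz])
  have hsub : (⋃ x ∈ X, Metric.ball x r) ⊆ Metric.ball y (R + r) :=
    Set.iUnion₂_subset fun x hx => Metric.ball_subset_ball' (by linarith [hX x hx])
  have hle := measureReal_mono hsub (μ := μ) measure_ball_lt_top.ne
  rw [measureReal_biUnion_finset hdisj fun x _ => measurableSet_ball] at hle
  have hball : ∀ (x : E) {ρ : ℝ}, 0 < ρ →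
      μ.real (Metric.ball x ρ) = ρ ^ Module.finrank ℝ E * μ.real (Metric.ball 0 1) := by
    intro x ρ hρ
    simp [measureReal_def, μ.addHaar_ball_of_pos x hρ, ENNReal.toReal_ofReal (pow_nonneg hρ.le _)]
  have hpos : 0 < μ.real (Metric.ball (0 : E) 1) :=
    ENNReal.toReal_pos (Metric.measure_ball_pos μ 0 one_pos).ne' measure_ball_lt_top.ne
  simp_rw [hball _ hr, hball y (by linarith : 0 < R + r)] at hle
  rw [Finset.sum_const, nsmul_eq_mul, ← mul_assoc, mul_le_mul_iff_left₀ hpos] at hle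
  have hrw : 1 + R / r = (R + r) / r := by field_simp; ring
  rw [hrw, div_pow, le_div_iff₀ (by positivity)]
  exact hle

/-! ### Gaussian measure and the dual Sudakov inequality -/

section Gaussian

/-- The unnormalized standard Gaussian density. -/
noncomputable def gaussianDensity {E : Type*} [Norm E] (x : E) : ℝ := Real.exp (-(1 / 2) * ‖x‖ ^ 2)

lemma gaussianDensity_pos {E : Type*} [Norm E] (x : E) : 0 < gaussianDensity x := Real.exp_pos _

lemma continuous_gaussianDensity {E : Type*} [SeminormedAddCommGroup E] :
    Continuous (gaussianDensity : E → ℝ) := by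
  unfold gaussianDensity; fun_prop

lemma gaussianDensity_neg {E : Type*} [SeminormedAddCommGroup E] (x : E) :
    gaussianDensity (-x) = gaussianDensity x := by
  simp [gaussianDensity]

/-- Expanding the squares leaves the factors `exp (∓⟪x, v⟫)`, whose sum is at least 2. Averaging
over `±v` is what makes symmetric sets lose so little under translation. -/
lemma two_mul_exp_mul_gaussianDensity_le {E : Type*} [NormedAddCommGroup E] [InnerProductSpace ℝ E]
    (x v : E) : 2 * (Real.exp (-(1 / 2) * ‖v‖ ^ 2) * gaussianDensity x) ≤
      gaussianDensity (x + v) + gaussianDensity (x - v) := by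
  have h1 : gaussianDensity (x + v) =
      Real.exp (-(1 / 2) * ‖v‖ ^ 2) * gaussianDensity x * Real.exp (-inner ℝ x v) := by
    simp only [gaussianDensity, ← Real.exp_add, norm_add_sq_real]; ring_nf
  have h2 : gaussianDensity (x - v) =
      Real.exp (-(1 / 2) * ‖v‖ ^ 2) * gaussianDensity x * Real.exp (inner ℝ x v) := by
    simp only [gaussianDensity, ← Real.exp_add, norm_sub_sq_real]; ring_nf
  have h3 := Real.add_one_le_exp (inner ℝ x v)
  have h4 := Real.add_one_le_exp (-inner ℝ x v)
  have h5 : 0 < Real.exp (-(1 / 2) * ‖v‖ ^ 2) * gaussianDensity x :=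
    mul_pos (Real.exp_pos _) (gaussianDensity_pos x)
  rw [h1, h2]
  nlinarith

variable {E : Type*} [NormedAddCommGroup E] [InnerProductSpace ℝ E] [FiniteDimensional ℝ E]
  [MeasurableSpace E] [BorelSpace E]

lemma integrable_exp_neg_mul_norm_sq {b : ℝ} (hb : 0 < b) :
    Integrable fun x : E => Real.exp (-b * ‖x‖ ^ 2) := by
  -- The integral of a non-integrable function is 0 by convention, so a nonzero value proves
  -- integrability.
  refine .of_integral_ne_zero ?_
  rw [GaussianFourier.integral_rexp_neg_mul_sq_norm hb]
  positivity

lemma integrable_gaussianDensity : Integrable (gaussianDensity : E → ℝ) :=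
  integrable_exp_neg_mul_norm_sq (by norm_num)

lemma integral_gaussianDensity_pos : 0 < ∫ x : E, gaussianDensity x := by
  unfold gaussianDensity
  rw [GaussianFourier.integral_rexp_neg_mul_sq_norm (by norm_num)]
  positivity

/-- Translating a symmetric set by `v` decreases its Gaussian measure at most by the factor
`exp (-‖v‖ ^ 2 / 2)`. -/
lemma exp_mul_setIntegral_gaussianDensity_le {T : Set E}
    (hsymm : ∀ x, -x ∈ T ↔ x ∈ T) (v : E) :
    Real.exp (-(1 / 2) * ‖v‖ ^ 2) * ∫ x in T, gaussianDensity x ≤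
      ∫ x in (fun x => x - v) ⁻¹' T, gaussianDensity x := by
  have hshift : ∫ x in (fun x => x - v) ⁻¹' T, gaussianDensity x =
      ∫ x in T, gaussianDensity (x + v) := by
    have := (measurePreserving_sub_right volume v).setIntegral_preimage_emb
      (MeasurableEquiv.subRight v).measurableEmbedding (fun x => gaussianDensity (x + v)) T
    simpa using this
  have hneg : ∫ x in T, gaussianDensity (x + v) = ∫ x in T, gaussianDensity (x - v) := by
    have := (Measure.measurePreserving_neg (volume : Measure E)).setIntegral_preimage_emb
      (MeasurableEquiv.neg E).measurableEmbedding (fun x => gaussianDensity (x + v)) T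
    have hpre : (Neg.neg ⁻¹' T : Set E) = T := Set.ext fun x => hsymm x
    rw [← this, hpre]
    refine integral_congr_ae (.of_forall fun x => ?_)
    change gaussianDensity (-x + v) = gaussianDensity (x - v)
    rw [← gaussianDensity_neg, neg_add, neg_neg, sub_eq_add_neg]
  have hp : IntegrableOn (fun x : E => gaussianDensity (x + v)) T :=
    (integrable_gaussianDensity.comp_add_right v).integrableOn
  have hm : IntegrableOn (fun x : E => gaussianDensity (x - v)) T :=
    (integrable_gaussianDensity.comp_sub_right v).integrableOn
  have hle : ∫ x in T, 2 * (Real.exp (-(1 / 2) * ‖v‖ ^ 2) * gaussianDensity x) ≤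
      ∫ x in T, (gaussianDensity (x + v) + gaussianDensity (x - v)) :=
    integral_mono ((integrable_gaussianDensity.integrableOn.const_mul _).const_mul _) (hp.add hm)
      fun x => two_mul_exp_mul_gaussianDensity_le x v
  rw [integral_const_mul, integral_const_mul, integral_add hp hm, ← hneg] at hle
  rw [hshift]
  linarith

/-- **Dual Sudakov inequality**: if the Gaussian mean of a seminorm `p` is at most `A`, then a
subset of a ball of radius `R` which is `s`-separated for `p` has at most
`exp (64 * (A * R / s) ^ 2)` elements. -/
lemma card_le_of_seminorm_separated (p : Seminorm ℝ E) (hp : Continuous p) {A R s : ℝ}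
    (hA : 0 < A) (hs : 0 < s)
    (hint : Integrable fun x => p x * gaussianDensity x)
    (hmean : ∫ x, p x * gaussianDensity x ≤ A * ∫ x : E, gaussianDensity x)
    (Z : Finset E) (y : E) (hZ : ∀ z ∈ Z, dist z y ≤ R)
    (hsep : (Z : Set E).Pairwise fun z w => s < p (z - w)) :
    (Z.card : ℝ) ≤ Real.exp (64 * (A * R / s) ^ 2) := by
  set I := ∫ x : E, gaussianDensity x with hI
  have hIpos : 0 < I := integral_gaussianDensity_pos
  let T : Set E := {u | p u ≤ 4 * A}
  have hT : MeasurableSet T := (isClosed_le hp continuous_const).measurableSet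
  have hsymm : ∀ x, -x ∈ T ↔ x ∈ T := fun x => by simp [T]
  -- Markov's inequality at four times the mean.
  have hTmass : 3 / 4 * I ≤ ∫ x in T, gaussianDensity x := by
    have h1 : ∫ x in Tᶜ, 4 * A * gaussianDensity x ≤ ∫ x in Tᶜ, p x * gaussianDensity x :=
      setIntegral_mono_on (integrable_gaussianDensity.integrableOn.const_mul _) hint.integrableOn
        hT.compl fun x hx => mul_le_mul_of_nonneg_right (not_le.1 (show ¬p x ≤ 4 * A from hx)).le
          (gaussianDensity_pos x).le
    have h2 : ∫ x in Tᶜ, p x * gaussianDensity x ≤ ∫ x, p x * gaussianDensity x :=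
      setIntegral_le_integral hint
        (.of_forall fun x => mul_nonneg (apply_nonneg p x) (gaussianDensity_pos x).le)
    have h3 := integral_add_compl hT (integrable_gaussianDensity (E := E))
    rw [integral_const_mul] at h1
    have h4 : 4 * ∫ x in Tᶜ, gaussianDensity x ≤ I := by
      refine le_of_mul_le_mul_left ?_ hA
      linarith
    linarith
  -- The dilation makes `p (v z - v w)` exceed `8 * A`, twice the `p`-radius of `T`, so the
  -- translates are disjoint.
  let v : E → E := fun z => (8 * A / s) • (z - y)
  have hdisj : (Z : Set E).PairwiseDisjoint fun z => (fun x => x - v z) ⁻¹' T := by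
    intro z hz w hw hzw
    refine Set.disjoint_left.2 fun u hu hu' => (hsep hz hw hzw).not_ge ?_
    have h1 : p (u - v z) ≤ 4 * A := hu
    have h2 : p (u - v w) ≤ 4 * A := hu'
    have h3 : (8 * A / s) • (z - w) = (u - v w) - (u - v z) := by
      simp only [v, smul_sub]; abel
    have h4 : p ((8 * A / s) • (z - w)) ≤ 8 * A := by
      rw [h3]; exact (map_sub_le_add p _ _).trans (by linarith)
    rw [map_smul_eq_mul, Real.norm_of_nonneg (by positivity), div_mul_eq_mul_div,
      div_le_iff₀ hs] at h4
    exact le_of_mul_le_mul_left h4 (by positivity)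
  have hmeas : ∀ z ∈ Z, MeasurableSet ((fun x => x - v z) ⁻¹' T) := fun z _ =>
    hT.preimage (measurable_id.sub_const _)
  have hsum : ∑ z ∈ Z, ∫ x in (fun x => x - v z) ⁻¹' T, gaussianDensity x ≤ I := by
    rw [← integral_biUnion_finset Z hmeas hdisj fun z _ => integrable_gaussianDensity.integrableOn]
    exact setIntegral_le_integral integrable_gaussianDensity
      (.of_forall fun x => (gaussianDensity_pos x).le)
  have hone : ∀ z ∈ Z, Real.exp (-(32 * (A * R / s) ^ 2)) * (3 / 4 * I) ≤
      ∫ x in (fun x => x - v z) ⁻¹' T, gaussianDensity x := by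
    intro z hz
    refine le_trans ?_ (exp_mul_setIntegral_gaussianDensity_le hsymm (v z))
    gcongr
    have h1 : ‖v z‖ ≤ 8 * A / s * R := by
      rw [norm_smul, Real.norm_of_nonneg (by positivity), ← dist_eq_norm]
      gcongr
      exact hZ z hz
    have h2 : ‖v z‖ ^ 2 ≤ (8 * A / s * R) ^ 2 := by gcongr
    have h3 : (8 * A / s * R) ^ 2 = 64 * (A * R / s) ^ 2 := by ring
    linarith
  have hcard := (Finset.card_nsmul_le_sum Z _ _ hone).trans hsum
  set X := 32 * (A * R / s) ^ 2 with hX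
  have hX2 : 64 * (A * R / s) ^ 2 = X + X := by ring
  have hX0 : 0 ≤ X := by positivity
  have hcard' : (Z.card : ℝ) * 3 ≤ 4 * Real.exp X := by
    rw [nsmul_eq_mul, Real.exp_neg] at hcard
    have : (Z.card : ℝ) * ((Real.exp X)⁻¹ * (3 / 4)) * I ≤ 1 * I := by linarith
    have := le_of_mul_le_mul_right this hIpos
    have h := mul_le_mul_of_nonneg_left this (Real.exp_pos X).le
    have h' : Real.exp X * (Real.exp X)⁻¹ = 1 := mul_inv_cancel₀ (Real.exp_pos X).ne'
    have : Real.exp X * ((Z.card : ℝ) * ((Real.exp X)⁻¹ * (3 / 4))) = Z.card * (3 / 4) := by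
      linear_combination (Z.card * (3 / 4) : ℝ) * h'
    linarith
  rw [hX2, Real.exp_add]
  have hexp : 1 ≤ Real.exp X := Real.one_le_exp hX0
  -- The factor 4/3 is absorbed by doubling the exponent: two or more points force `exp X ≥ 3/2`.
  rcases Nat.lt_or_ge Z.card 2 with h | h
  · have : (Z.card : ℝ) ≤ 1 := by exact_mod_cast Nat.le_of_lt_succ h
    nlinarith
  · have : (2 : ℝ) ≤ Z.card := by exact_mod_cast h
    nlinarith

/-- The Gaussian mean of the norm is at most `2 * √n`. -/
lemma integral_norm_mul_gaussianDensity_le [Nontrivial E] :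
    Integrable (fun x : E => ‖x‖ * gaussianDensity x) ∧
    ∫ x : E, ‖x‖ * gaussianDensity x ≤
      2 * √(Module.finrank ℝ E) * ∫ x : E, gaussianDensity x := by
  set d := Module.finrank ℝ E
  have hd : (1 : ℝ) ≤ d := by exact_mod_cast (Module.finrank_pos : 0 < Module.finrank ℝ E)
  -- AM-GM gives `‖x‖ ≤ √d * exp (‖x‖ ^ 2 / (4 * d))`, which is absorbed into the density. The
  -- normalization then grows by at most `exp (1 / d) ^ (d / 2) = exp (1 / 2) ≤ 2`.
  set b : ℝ := 1 / 2 - 1 / (4 * d) with hb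
  have hbpos : 0 < b := by
    rw [hb, sub_pos, div_lt_div_iff₀ (by positivity) (by norm_num)]; linarith
  have hpt : ∀ x : E, ‖x‖ * gaussianDensity x ≤ √d * Real.exp (-b * ‖x‖ ^ 2) := by
    intro x
    have hsq : √(d : ℝ) ^ 2 = d := Real.sq_sqrt (by linarith)
    have hs : 0 < √(d : ℝ) := Real.sqrt_pos.2 (by linarith)
    have h1 : ‖x‖ ≤ √d * (‖x‖ ^ 2 / (4 * d) + 1) := by
      have : √d * (‖x‖ ^ 2 / (4 * d) + 1) - ‖x‖ = (‖x‖ - 2 * √d) ^ 2 / (4 * √d) := by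
        nth_rewrite 2 [← hsq]
        field_simp
        ring
      have h0 : 0 ≤ (‖x‖ - 2 * √d) ^ 2 / (4 * √d) := by positivity
      linarith
    have h2 : Real.exp (-b * ‖x‖ ^ 2) = Real.exp (‖x‖ ^ 2 / (4 * d)) * gaussianDensity x := by
      rw [gaussianDensity, ← Real.exp_add, hb]; ring_nf
    rw [h2, ← mul_assoc]
    refine mul_le_mul_of_nonneg_right (h1.trans ?_) (gaussianDensity_pos x).le
    gcongr
    exact Real.add_one_le_exp _
  have hint := (integrable_exp_neg_mul_norm_sq (E := E) hbpos).const_mul √d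
  have hint' : Integrable (fun x : E => ‖x‖ * gaussianDensity x) := by
    refine hint.mono' (continuous_norm.mul continuous_gaussianDensity).aestronglyMeasurable
      (.of_forall fun x => ?_)
    rw [Real.norm_of_nonneg (mul_nonneg (norm_nonneg x) (gaussianDensity_pos x).le)]
    exact hpt x
  refine ⟨hint', (integral_mono hint' hint hpt).trans ?_⟩
  have hratio : (Real.pi / b) ^ (d / 2 : ℝ) ≤ 2 * (Real.pi / (1 / 2)) ^ (d / 2 : ℝ) := by
    have h1 : Real.pi / b ≤ Real.exp (1 / d) * (Real.pi / (1 / 2)) := by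
      have : 1 / b ≤ Real.exp (1 / d) * 2 := by
        have h2 : 1 / b ≤ (1 / d + 1) * 2 := by
          rw [div_le_iff₀ hbpos, hb]
          field_simp
          nlinarith
        linarith [Real.add_one_le_exp (1 / d : ℝ)]
      have h3 := mul_le_mul_of_nonneg_left this Real.pi_pos.le
      calc Real.pi / b = Real.pi * (1 / b) := by ring
        _ ≤ _ := h3
        _ = _ := by ring
    calc (Real.pi / b) ^ (d / 2 : ℝ) ≤ (Real.exp (1 / d) * (Real.pi / (1 / 2))) ^ (d / 2 : ℝ) := by
          gcongr
      _ = Real.exp (1 / 2) * (Real.pi / (1 / 2)) ^ (d / 2 : ℝ) := by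
          rw [Real.mul_rpow (Real.exp_pos _).le (by positivity), ← Real.exp_mul]
          congr 2
          field_simp
      _ ≤ _ := by
          gcongr
          have h4 : Real.exp (1 / 2) ^ 2 = Real.exp 1 := by
            rw [← Real.exp_nat_mul]; norm_num
          nlinarith [Real.exp_one_lt_d9, Real.exp_pos (1 / 2)]
  unfold gaussianDensity
  rw [integral_const_mul, GaussianFourier.integral_rexp_neg_mul_sq_norm hbpos,
    GaussianFourier.integral_rexp_neg_mul_sq_norm (by norm_num)]
  nlinarith [Real.sqrt_nonneg (d : ℝ), mul_le_mul_of_nonneg_left hratio (Real.sqrt_nonneg (d : ℝ))]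

end Gaussian

/-! ### Sudakov minoration by dyadic scales -/

/-- **Sudakov minoration** in terms of a Gaussian mean of a seminorm dominating the width
function. -/
lemma card_le_of_separated_of_gaussian_mean {E : Type*} [NormedAddCommGroup E]
    [InnerProductSpace ℝ E] [FiniteDimensional ℝ E] [MeasurableSpace E] [BorelSpace E]
    {K : Set E} (p : Seminorm ℝ E) (hp : Continuous p)
    (hKp : ∀ x ∈ K, ∀ y ∈ K, ∀ u, inner ℝ (x - y) u ≤ p u) {A : ℝ} (hA : 0 < A)
    (hint : Integrable fun x => p x * gaussianDensity x)
    (hmean : ∫ x, p x * gaussianDensity x ≤ A * ∫ x : E, gaussianDensity x)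
    {δ : ℝ} (hδ : 0 < δ) (X : Finset E) (hXK : ∀ x ∈ X, x ∈ K)
    (hsep : (X : Set E).Pairwise fun x y => δ < dist x y) :
    (X.card : ℝ) ≤ Real.exp (342 * (A / δ) ^ 2) := by
  -- Induction on the dyadic ratio of diameter to separation; `δ` varies because the step passes to
  -- `2 * δ`.
  suffices H : ∀ (k : ℕ) (δ : ℝ), 0 < δ → ∀ X : Finset E, (∀ x ∈ X, x ∈ K) →
      (X : Set E).Pairwise (fun x y => δ < dist x y) →
      (∀ x ∈ X, ∀ y ∈ X, dist x y ≤ 2 ^ k * δ) →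
      (X.card : ℝ) ≤ Real.exp (342 * (A / δ) ^ 2) by
    obtain ⟨k, hk⟩ := pow_unbounded_of_one_lt (Metric.diam (X : Set E) / δ) one_lt_two
    refine H k δ hδ X hXK hsep fun x hx y hy => ?_
    rw [div_lt_iff₀ hδ] at hk
    exact (Metric.dist_le_diam_of_mem X.finite_toSet.isBounded hx hy).trans hk.le
  intro k
  induction k with
  | zero =>
    intro δ hδ X _ hsep hdiam
    have : X.card ≤ 1 := Finset.card_le_one.2 fun x hx y hy => by
      by_contra hxy
      have h1 := hsep hx hy hxy
      have h2 := hdiam x hx y hy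
      simp only [pow_zero, one_mul] at h2
      linarith
    exact le_trans (by exact_mod_cast this) (Real.one_le_exp (by positivity))
  | succ k ih =>
    intro δ hδ X hXK hsep hdiam
    -- The net contributes `342 / 4` and each cluster `64 * 2 ^ 2 = 256`, in total less than 342.
    refine (card_le_mul_of_separated X (η := 2 * δ) (by positivity) (Real.exp_pos _).le
      (fun Y hY hYsep => ih (2 * δ) (by positivity) Y (fun x hx => hXK x (hY hx)) hYsep
        fun x hx y hy => (hdiam x (hY hx) y (hY hy)).trans_eq (by ring))
      (fun y _ Z hZ hZy => card_le_of_seminorm_separated p hp hA (s := δ ^ 2) (by positivity)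
        hint hmean Z y hZy fun z hz w hw hzw => ?_)).trans ?_
    · have h1 := hsep (hZ hz) (hZ hw) hzw
      have h2 := hKp z (hXK z (hZ hz)) w (hXK w (hZ hw)) (z - w)
      rw [real_inner_self_eq_norm_sq, ← dist_eq_norm] at h2
      exact (by gcongr : δ ^ 2 < dist z w ^ 2).trans_le h2
    · rw [← Real.exp_add]
      gcongr
      have h1 : A / (2 * δ) = 1 / 2 * (A / δ) := by field_simp
      have h2 : A * (2 * δ) / δ ^ 2 = 2 * (A / δ) := by field_simp
      rw [h1, h2]
      nlinarith [sq_nonneg (A / δ)]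

/-! ### Support function and width seminorm -/

section SupportFunction

variable {n : ℕ} {K : Set (EuclideanSpace ℝ (Fin n))}

lemma continuous_supportFunction (hK : IsCompact K) : Continuous (supportFunction K) :=
  hK.continuous_sSup (f := fun θ x => inner ℝ x θ)
    (continuous_snd.inner continuous_fst)

lemma inner_le_supportFunction (hK : IsCompact K) {x : EuclideanSpace ℝ (Fin n)} (hx : x ∈ K)
    (θ : EuclideanSpace ℝ (Fin n)) : inner ℝ x θ ≤ supportFunction K θ :=
  le_csSup (hK.image (by fun_prop)).bddAbove (Set.mem_image_of_mem _ hx)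

lemma supportFunction_le (hne : K.Nonempty) {θ : EuclideanSpace ℝ (Fin n)} {a : ℝ}
    (h : ∀ x ∈ K, inner ℝ x θ ≤ a) : supportFunction K θ ≤ a :=
  csSup_le (hne.image _) (by rintro _ ⟨x, hx, rfl⟩; exact h x hx)

lemma supportFunction_smul {c : ℝ} (hc : 0 ≤ c) (θ : EuclideanSpace ℝ (Fin n)) :
    supportFunction K (c • θ) = c * supportFunction K θ := by
  rw [supportFunction, supportFunction, ← smul_eq_mul, ← Real.sSup_smul_of_nonneg hc,
    ← Set.image_smul, Set.image_image]
  simp only [inner_smul_right, smul_eq_mul]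

lemma supportFunction_add_le (hK : IsCompact K) (hne : K.Nonempty)
    (θ η : EuclideanSpace ℝ (Fin n)) :
    supportFunction K (θ + η) ≤ supportFunction K θ + supportFunction K η :=
  supportFunction_le hne fun x hx => by
    rw [inner_add_right]
    exact add_le_add (inner_le_supportFunction hK hx θ) (inner_le_supportFunction hK hx η)

/-- The width function `θ ↦ h_K(θ) + h_K(-θ)` of a nonempty compact set is a seminorm. -/
noncomputable def widthSeminorm (hK : IsCompact K) (hne : K.Nonempty) :
    Seminorm ℝ (EuclideanSpace ℝ (Fin n)) :=
  Seminorm.of (fun θ => supportFunction K θ + supportFunction K (-θ))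
    (fun θ η => by
      have h1 := supportFunction_add_le hK hne θ η
      have h2 := supportFunction_add_le hK hne (-θ) (-η)
      rw [neg_add]
      linarith)
    (fun c θ => by
      rcases le_total 0 c with hc | hc
      · rw [← smul_neg, supportFunction_smul hc, supportFunction_smul hc, Real.norm_of_nonneg hc,
          mul_add]
      · have hc' : 0 ≤ -c := neg_nonneg.2 hc
        have h1 : c • θ = (-c) • (-θ) := by simp
        rw [← neg_smul, h1, supportFunction_smul hc', supportFunction_smul hc',
          Real.norm_of_nonpos hc, mul_add, add_comm])

lemma widthSeminorm_apply (hK : IsCompact K) (hne : K.Nonempty)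
    (θ : EuclideanSpace ℝ (Fin n)) :
    widthSeminorm hK hne θ = supportFunction K θ + supportFunction K (-θ) := rfl

lemma continuous_widthSeminorm (hK : IsCompact K) (hne : K.Nonempty) :
    Continuous (widthSeminorm hK hne) := by
  have h := continuous_supportFunction hK
  exact h.add (h.comp continuous_neg)

lemma inner_sub_le_widthSeminorm (hK : IsCompact K) (hne : K.Nonempty)
    {x y : EuclideanSpace ℝ (Fin n)} (hx : x ∈ K) (hy : y ∈ K) (θ : EuclideanSpace ℝ (Fin n)) :
    inner ℝ (x - y) θ ≤ widthSeminorm hK hne θ := by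
  have h1 := inner_le_supportFunction hK hx θ
  have h2 := inner_le_supportFunction hK hy (-θ)
  rw [inner_neg_right] at h2
  rw [widthSeminorm_apply, inner_sub_left]
  linarith

lemma exists_abs_supportFunction_le (hK : IsCompact K) (hne : K.Nonempty) :
    ∃ c : ℝ, ∀ θ, |supportFunction K θ| ≤ c * ‖θ‖ := by
  obtain ⟨c, hc⟩ := hK.isBounded.exists_norm_le
  obtain ⟨x, hx⟩ := hne
  have hin : ∀ x ∈ K, ∀ θ, |inner ℝ x θ| ≤ c * ‖θ‖ := fun x hx θ =>
    (abs_real_inner_le_norm x θ).trans (by gcongr; exact hc x hx)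
  refine ⟨c, fun θ => abs_le.2 ⟨?_, supportFunction_le ⟨x, hx⟩ fun y hy =>
    (le_abs_self _).trans (hin y hy θ)⟩⟩
  exact (abs_le.1 (hin x hx θ)).1.trans (inner_le_supportFunction hK hx θ)

end SupportFunction

/-- Polar integration of a positively homogeneous function against a radial density. -/
lemma integral_mul_norm_of_posHomogeneous {E : Type*} [NormedAddCommGroup E] [NormedSpace ℝ E]
    [MeasurableSpace E] [BorelSpace E] [FiniteDimensional ℝ E] [Nontrivial E] (μ : Measure E)
    [μ.IsAddHaarMeasure] (f : E → ℝ) (hf : ∀ (c : ℝ) (x : E), 0 < c → f (c • x) = c * f x)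
    (g : ℝ → ℝ) :
    ∫ x, f x * g ‖x‖ ∂μ = (∫ θ : Metric.sphere (0 : E) 1, f θ ∂μ.toSphere) *
      ∫ r : Set.Ioi (0 : ℝ), r * g r ∂Measure.volumeIoiPow (Module.finrank ℝ E - 1) := by
  calc ∫ x, f x * g ‖x‖ ∂μ
      = ∫ x : ({(0)}ᶜ : Set E), f x.1 * g ‖x.1‖ ∂(μ.comap (↑)) := by
        rw [integral_subtype_comap (measurableSet_singleton _).compl fun x ↦ f x * g ‖x‖,
          restrict_compl_singleton]
    _ = ∫ x : ({(0)}ᶜ : Set E), f ((homeomorphUnitSphereProd E x).1 : E) *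
          ((homeomorphUnitSphereProd E x).2 * g (homeomorphUnitSphereProd E x).2)
          ∂(μ.comap (↑)) := by
        refine integral_congr_ae (.of_forall fun x => ?_)
        have hx : 0 < ‖x.1‖ := norm_pos_iff.2 x.2
        simp only [homeomorphUnitSphereProd_apply_fst_coe, homeomorphUnitSphereProd_apply_snd_coe]
        rw [hf _ _ (inv_pos.2 hx)]
        field_simp
    _ = ∫ x, f x.1 * (x.2 * g x.2)
          ∂μ.toSphere.prod (.volumeIoiPow (Module.finrank ℝ E - 1)) :=
        μ.measurePreserving_homeomorphUnitSphereProd.integral_comp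
          (Homeomorph.measurableEmbedding _)
          fun x : Metric.sphere (0 : E) 1 × Set.Ioi (0 : ℝ) => f x.1 * (x.2 * g x.2)
    _ = _ := integral_prod_mul (fun θ : Metric.sphere (0 : E) 1 => f θ)
        fun r : Set.Ioi (0 : ℝ) => (r : ℝ) * g r

/-! ### Half mean width as a Gaussian mean -/

section HalfMeanWidth

variable {n : ℕ} {K : Set (EuclideanSpace ℝ (Fin n))}

/-- In polar coordinates `supportFunction K` and the norm have the same radial integral. The norm is
1 on the sphere, so the ratio of the two Gaussian means is the spherical average of `supportFunction
K`. -/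
lemma integral_supportFunction_mul_gaussianDensity [NeZero n] :
    ∫ x, supportFunction K x * gaussianDensity x =
      halfMeanWidth K * ∫ x : EuclideanSpace ℝ (Fin n), ‖x‖ * gaussianDensity x := by
  let g : ℝ → ℝ := fun r => Real.exp (-(1 / 2) * r ^ 2)
  have h1 := integral_mul_norm_of_posHomogeneous (volume : Measure (EuclideanSpace ℝ (Fin n)))
    (supportFunction K) (fun c x hc => supportFunction_smul hc.le x) g
  have h2 := integral_mul_norm_of_posHomogeneous (volume : Measure (EuclideanSpace ℝ (Fin n)))
    (fun x => ‖x‖) (fun c x hc => by rw [norm_smul, Real.norm_of_nonneg hc.le]) g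
  have hS : (volume : Measure (EuclideanSpace ℝ (Fin n))).toSphere.real Set.univ ≠ 0 :=
    have : NeZero (volume : Measure (EuclideanSpace ℝ (Fin n))).toSphere :=
      ⟨Measure.toSphere_ne_zero _⟩
    measureReal_univ_ne_zero
  simp only [norm_eq_of_mem_sphere, integral_const, smul_eq_mul, mul_one] at h2
  change _ = _ * ∫ x : EuclideanSpace ℝ (Fin n), ‖x‖ * g ‖x‖
  change ∫ x, supportFunction K x * g ‖x‖ = _
  rw [h1, h2, halfMeanWidth, sphereProb, integral_smul_measure, ENNReal.toReal_inv,
    ← measureReal_def, smul_eq_mul]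
  field_simp

lemma integrable_supportFunction_mul_gaussianDensity [NeZero n] (hK : IsCompact K)
    (hne : K.Nonempty) : Integrable fun x => supportFunction K x * gaussianDensity x := by
  obtain ⟨c, hc⟩ := exists_abs_supportFunction_le hK hne
  refine (integral_norm_mul_gaussianDensity_le.1.const_mul c).mono'
    ((continuous_supportFunction hK).mul continuous_gaussianDensity).aestronglyMeasurable
    (.of_forall fun x => ?_)
  rw [norm_mul, Real.norm_of_nonneg (gaussianDensity_pos x).le, ← mul_assoc]
  exact mul_le_mul_of_nonneg_right (hc x) (gaussianDensity_pos x).le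

lemma integrable_widthSeminorm_mul_gaussianDensity [NeZero n] (hK : IsCompact K)
    (hne : K.Nonempty) : Integrable fun x => widthSeminorm hK hne x * gaussianDensity x := by
  have h := integrable_supportFunction_mul_gaussianDensity hK hne
  refine (h.add h.comp_neg).congr (.of_forall fun x => ?_)
  simp [widthSeminorm_apply, gaussianDensity_neg, add_mul]

lemma integral_widthSeminorm_mul_gaussianDensity [NeZero n] (hK : IsCompact K)
    (hne : K.Nonempty) : ∫ x, widthSeminorm hK hne x * gaussianDensity x =
      2 * halfMeanWidth K * ∫ x : EuclideanSpace ℝ (Fin n), ‖x‖ * gaussianDensity x := by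
  have h := integrable_supportFunction_mul_gaussianDensity hK hne
  have heq : ∀ x, widthSeminorm hK hne x * gaussianDensity x = supportFunction K x *
      gaussianDensity x + supportFunction K (-x) * gaussianDensity (-x) := fun x => by
    rw [widthSeminorm_apply, gaussianDensity_neg, add_mul]
  simp_rw [heq]
  rw [integral_add h h.comp_neg,
    integral_neg_eq_self (fun x => supportFunction K x * gaussianDensity x),
    integral_supportFunction_mul_gaussianDensity]
  ring

/-- The support function may be negative when `0 ∉ K`, but its symmetrization, the width, is not. -/
lemma halfMeanWidth_nonneg [NeZero n] (hK : IsCompact K) (hne : K.Nonempty) :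
    0 ≤ halfMeanWidth K := by
  have h0 : 0 ≤ ∫ x, widthSeminorm hK hne x * gaussianDensity x :=
    integral_nonneg fun x => mul_nonneg (apply_nonneg _ x) (gaussianDensity_pos x).le
  obtain ⟨x₀, hx₀⟩ := exists_ne (0 : EuclideanSpace ℝ (Fin n))
  have hpos : 0 < ∫ x : EuclideanSpace ℝ (Fin n), ‖x‖ * gaussianDensity x :=
    integral_pos_of_integrable_nonneg_nonzero (x := x₀)
      (Continuous.mul continuous_norm continuous_gaussianDensity)
      integral_norm_mul_gaussianDensity_le.1
      (fun x => mul_nonneg (norm_nonneg x) (gaussianDensity_pos x).le)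
      (mul_pos (norm_pos_iff.2 hx₀) (gaussianDensity_pos x₀)).ne'
  rw [integral_widthSeminorm_mul_gaussianDensity] at h0
  have := nonneg_of_mul_nonneg_left h0 hpos
  linarith

/-- **Sudakov minoration** for the half mean width. -/
lemma card_le_of_separated_of_halfMeanWidth_le [NeZero n] (hK : IsCompact K) {m δ : ℝ}
    (hm : 0 < m) (hKm : halfMeanWidth K ≤ m) (hδ : 0 < δ)
    (X : Finset (EuclideanSpace ℝ (Fin n))) (hXK : ∀ x ∈ X, x ∈ K)
    (hsep : (X : Set (EuclideanSpace ℝ (Fin n))).Pairwise fun x y => δ < dist x y) :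
    (X.card : ℝ) ≤ Real.exp (5472 * n * (m / δ) ^ 2) := by
  rcases X.eq_empty_or_nonempty with rfl | ⟨x₀, hx₀⟩
  · simpa using (Real.exp_pos _).le
  have hne : K.Nonempty := ⟨x₀, hXK x₀ hx₀⟩
  have hn : (0 : ℝ) < n := by exact_mod_cast Nat.pos_of_neZero n
  have hmean : ∫ x, widthSeminorm hK hne x * gaussianDensity x ≤
      (4 * √n * m) * ∫ x : EuclideanSpace ℝ (Fin n), gaussianDensity x := by
    have h1 := (integral_norm_mul_gaussianDensity_le (E := EuclideanSpace ℝ (Fin n))).2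
    rw [finrank_euclideanSpace_fin] at h1
    have h2 : 0 ≤ ∫ x : EuclideanSpace ℝ (Fin n), ‖x‖ * gaussianDensity x :=
      integral_nonneg fun x => mul_nonneg (norm_nonneg x) (gaussianDensity_pos x).le
    rw [integral_widthSeminorm_mul_gaussianDensity]
    nlinarith [mul_le_mul_of_nonneg_right hKm h2, mul_le_mul_of_nonneg_left h1 hm.le]
  have hA : 0 < 4 * √(n : ℝ) * m := by positivity
  refine (card_le_of_separated_of_gaussian_mean (widthSeminorm hK hne)
    (continuous_widthSeminorm hK hne)
    (fun x hx y hy u => inner_sub_le_widthSeminorm hK hne hx hy u) hA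
    (integrable_widthSeminorm_mul_gaussianDensity hK hne) hmean hδ X hXK hsep).trans_eq ?_
  -- The constant is `5472 = 342 * 4 ^ 2`.
  congr 1
  have : (4 * √(n : ℝ) * m / δ) ^ 2 = 16 * √(n : ℝ) ^ 2 * (m / δ) ^ 2 := by ring
  rw [this, Real.sq_sqrt hn.le]
  ring

end HalfMeanWidth

/-! ### The two regimes of `t` and the packing number -/

variable {n : ℕ} {K : Set (EuclideanSpace ℝ (Fin n))}

/-- Any positive `m` is admissible in Sudakov's bound, so a small one applied to a pair of distinct
points would give `2 ≤ exp (1 / 2)`. -/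
lemma card_le_one_of_halfMeanWidth_eq_zero [NeZero n] (hK : IsCompact K)
    (hK0 : halfMeanWidth K = 0) (X : Finset (EuclideanSpace ℝ (Fin n)))
    (hXK : ∀ x ∈ X, x ∈ K) : X.card ≤ 1 := by
  classical
  refine Finset.card_le_one.2 fun x hx y hy => ?_
  by_contra hxy
  have hn : (1 : ℝ) ≤ n := by exact_mod_cast Nat.pos_of_neZero n
  have hd : 0 < dist x y := dist_pos.2 hxy
  have hδ : 0 < dist x y / 2 := by positivity
  have h := card_le_of_separated_of_halfMeanWidth_le hK (m := dist x y / 2 / (110 * n))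
    (by positivity) (hK0.trans_le (by positivity)) hδ {x, y}
    (by
      intro z hz
      rcases Finset.mem_insert.1 hz with rfl | hz
      · exact hXK _ hx
      · exact Finset.mem_singleton.1 hz ▸ hXK _ hy)
    (by
      rw [Finset.coe_pair, Set.pairwise_pair]
      intro _
      rw [dist_comm y x]
      constructor <;> linarith)
  rw [Finset.card_pair hxy] at h
  have h1 : dist x y / 2 / (110 * n) / (dist x y / 2) = 1 / (110 * n) := by field_simp
  have h2 : 5472 * (n : ℝ) * (1 / (110 * n)) ^ 2 ≤ 1 / 2 := by
    have : 5472 * (n : ℝ) * (1 / (110 * n)) ^ 2 = 5472 / 12100 * (1 / n) := by field_simp; norm_num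
    rw [this]
    have : 1 / (n : ℝ) ≤ 1 := by rw [div_le_one (by linarith)]; exact hn
    linarith
  rw [h1] at h
  have h3 := h.trans (Real.exp_le_exp.2 h2)
  have h4 : Real.exp (1 / 2) ^ 2 = Real.exp 1 := by
    rw [← Real.exp_nat_mul]; norm_num
  push_cast at h3
  nlinarith [Real.exp_one_lt_d9]

/-- Improved Sudakov minoration for finite separated sets. -/
lemma card_le_exp_div_max [NeZero n] (hK : IsCompact K) (hne : K.Nonempty) {t : ℝ} (ht : 0 < t)
    (X : Finset (EuclideanSpace ℝ (Fin n))) (hXK : ∀ x ∈ X, x ∈ K)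
    (hsep : (X : Set (EuclideanSpace ℝ (Fin n))).Pairwise
      fun x y => 2 * (500 * t * halfMeanWidth K) < dist x y) :
    (X.card : ℝ) ≤ Real.exp (n / max t (t ^ 2)) := by
  have hn : (0 : ℝ) < n := by exact_mod_cast Nat.pos_of_neZero n
  rcases (halfMeanWidth_nonneg hK hne).eq_or_lt' with hM | hM
  · exact le_trans (by exact_mod_cast card_le_one_of_halfMeanWidth_eq_zero hK hM X hXK)
      (Real.one_le_exp (by positivity))
  set m := halfMeanWidth K
  rcases le_or_gt 1 t with h1 | h1
  · refine (card_le_of_separated_of_halfMeanWidth_le hK hM le_rfl (by positivity) X hXK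
      hsep).trans (Real.exp_le_exp.2 ?_)
    have h2 : m / (2 * (500 * t * m)) = 1 / (1000 * t) := by field_simp; norm_num
    rw [max_eq_right (by nlinarith), h2, le_div_iff₀ (by positivity)]
    have h3 : 5472 * (n : ℝ) * (1 / (1000 * t)) ^ 2 * t ^ 2 = 5472 / 1000000 * n := by
      field_simp; norm_num
    linarith
  · have hpow : (1 + 125 * m / (500 * t * m)) ^ n ≤ Real.exp (n / (4 * t)) := by
      have h2 : 1 + 125 * m / (500 * t * m) ≤ Real.exp (1 / (4 * t)) := by
        have : 125 * m / (500 * t * m) = 1 / (4 * t) := by field_simp; norm_num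
        rw [this, add_comm]
        exact Real.add_one_le_exp _
      calc (1 + 125 * m / (500 * t * m)) ^ n ≤ Real.exp (1 / (4 * t)) ^ n := by gcongr
        _ = Real.exp (n / (4 * t)) := by rw [← Real.exp_nat_mul]; ring_nf
    -- At scale `125 * m` the net costs `5472 / 125 ^ 2 * n < 0.36 * n ≤ 0.36 * (n / t)`, and volume
    -- inside each ball costs `n / (4 * t)`; together they stay below `n / t`.
    refine (card_le_mul_of_separated X (η := 125 * m) (by positivity) (Real.exp_pos (n / (4 * t))).le
      (fun Y hY hYsep => card_le_of_separated_of_halfMeanWidth_le hK hM le_rfl (by positivity) Y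
        (fun x hx => hXK x (hY hx)) hYsep)
      (fun y _ Z hZ hZy => ?_)).trans ?_
    · refine le_trans ?_ hpow
      have := card_le_of_separated_subset_closedBall Z (r := 500 * t * m) (R := 125 * m)
        (by positivity) (by positivity) y hZy (hsep.mono (by exact_mod_cast hZ))
      rwa [finrank_euclideanSpace_fin] at this
    · rw [← Real.exp_add, Real.exp_le_exp, max_eq_left (by nlinarith)]
      have h2 : m / (125 * m) = 1 / 125 := by field_simp
      have h3 : (n : ℝ) ≤ n / t := by rw [le_div_iff₀ ht]; nlinarith
      have h4 : (n : ℝ) / (4 * t) = 1 / 4 * (n / t) := by field_simp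
      rw [h2, h4]
      linarith

lemma packingNumber_le_of_forall {E : Type*} [AddGroup E] {A B : Set E} {b : ℝ} (hb : 0 ≤ b)
    (h : ∀ (M : ℕ) (x : Fin M → E), (∀ i, x i ∈ A) →
      Pairwise (fun i j => Disjoint (x i +ᵥ B) (x j +ᵥ B)) → (M : ℝ) ≤ b) :
    (packingNumber A B : ℝ≥0∞) ≤ ENNReal.ofReal b := by
  have h1 : packingNumber A B ≤ (⌊b⌋₊ : ℕ∞) := iSup₂_le fun M ⟨x, hx, hd⟩ => by
    exact_mod_cast Nat.le_floor (h M x hx hd)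
  calc (packingNumber A B : ℝ≥0∞) ≤ ((⌊b⌋₊ : ℕ∞) : ℝ≥0∞) := by exact_mod_cast h1
    _ = ENNReal.ofReal (⌊b⌋₊ : ℝ) := by simp
    _ ≤ ENNReal.ofReal b := ENNReal.ofReal_le_ofReal (Nat.floor_le hb)

end SudakovMinoration

theorem theorem3p1 :
    ∃ C : ℝ, 1 ≤ C ∧
      ∀ (n : ℕ) (K : Set (EuclideanSpace ℝ (Fin n))), IsCompact K →
        ∀ t : ℝ, 0 < t →
          (SudakovMinoration.packingNumber K
              ((C * t * SudakovMinoration.halfMeanWidth K) •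
                Metric.closedBall (0 : EuclideanSpace ℝ (Fin n)) 1) : ℝ≥0∞)
            ≤ ENNReal.ofReal (Real.exp ((n : ℝ) / max t (t ^ 2))) := by
  classical
  refine ⟨500, by norm_num, fun n K hK t ht =>
    SudakovMinoration.packingNumber_le_of_forall (Real.exp_pos _).le fun M x hxK hdisj => ?_⟩
  -- The dilated ball is nonempty even for a zero factor, so disjoint translates have distinct
  -- centres.
  have hinj : Function.Injective x := fun i j hij => by
    by_contra hne
    have h := hdisj hne
    simp only [hij, disjoint_self, Set.bot_eq_empty, Set.vadd_set_eq_empty,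
      Set.smul_set_eq_empty, Metric.closedBall_eq_empty] at h
    linarith
  -- In dimension 0 the space is a single point, so at most one translate fits.
  rcases Nat.eq_zero_or_pos n with rfl | hn
  · have hM : M ≤ 1 := by simpa using Fintype.card_le_one_iff_subsingleton.2 hinj.subsingleton
    refine le_trans (by exact_mod_cast hM) (Real.one_le_exp (by simp))
  rcases Nat.eq_zero_or_pos M with rfl | hM
  · simpa using (Real.exp_pos _).le
  have : NeZero n := ⟨hn.ne'⟩
  have hne : K.Nonempty := ⟨x ⟨0, hM⟩, hxK _⟩
  have hr : 0 ≤ 500 * t * SudakovMinoration.halfMeanWidth K :=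
    mul_nonneg (by positivity) (SudakovMinoration.halfMeanWidth_nonneg hK hne)
  have h := SudakovMinoration.card_le_exp_div_max hK hne ht (Finset.univ.image x)
    (by simpa using hxK) (by
      rw [Finset.coe_image, Finset.coe_univ, Set.image_univ]
      rintro _ ⟨i, rfl⟩ _ ⟨j, rfl⟩ hij
      have hd := hdisj (ne_of_apply_ne x hij)
      rw [smul_unitClosedBall_of_nonneg hr, Metric.vadd_closedBall, Metric.vadd_closedBall, vadd_eq_add,
        vadd_eq_add, add_zero, add_zero, disjoint_closedBall_closedBall_iff hr hr] at hd
      linarith)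
  rwa [Finset.card_image_of_injective _ hinj, Finset.card_univ, Fintype.card_fin] at h
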